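/- Let $m_1,m_2,\dots$ be natural numbers and write $\mathbb R^\infty=\prod_{j=1}^\infty\mathbb R^{m_j}$, with the product topology. For each $j$ let $\mu_j$ be a convex (logarithmically concave) Borel probability measure on $\mathbb R^{m_j}$, that is, $\mu_j(tA+(1-t)B)\ge\mu_j(A)^t\mu_j(B)^{1-t}$ for all nonempty Borel sets $A,B$ and all $t\in[0,1]$, and let $\mu=\bigotimes_{j=1}^\infty\mu_j$. Let $f:\mathbb R^\infty\to\mathbb R$ be a $\mu$-measurable linear functional (linear on all of $\mathbb R^\infty$ and measurable with respect to the $\mu$-completion of the Borel $\sigma$-algebra). Writing points of $\mathbb R^\infty$ as $(x_1,x_2,\dots)$ with blocks $x_j\in\mathbb R^{m_j}$, put, for $k\ge 0$, $$c_k=\int_{\prod_{j>k}\mathbb R^{m_j}} f(0,\dots,0,x_{k+1},x_{k+2},\dots)\,\Bigl(\bigotimes_{j>k}\mu_j\Bigr)(d(x_{k+1},x_{k+2},\dots)),$$ where the first $k$ blocks of the argument of $f$ are zero, and let $\mathfrak B_k$ be the $\sigma$-algebra generated by the coordinates of the first $k$ blocks. Suppose that $c_k\to 0$ as $k\to\infty$.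 Then $f$ is the $\mu$-almost everywhere limit of a sequence of continuous linear functionals on $\mathbb R^\infty$. More precisely: $f$ is $\mu$-integrable, the integrals defining all the $c_k$ converge absolutely, the functionals $g_k(x)=f(x_1,\dots,x_k,0,0,\dots)$ are linear and continuous on $\mathbb R^\infty$, $g_k=\mathbb E_\mu^{\mathfrak B_k}f-c_k$ holds $\mu$-almost everywhere for each $k$, and $g_k\to f$ $\mu$-almost everywhere. -/

import Mathlib

open MeasureTheory Filter Topology
open scoped Pointwise ENNReal

/-- A measure `μ` is convex (logarithmically concave) if
`μ (t A + (1 - t) B) ≥ μ(A)^t μ(B)^(1-t)` for all nonempty measurable `A`, `B` and `t ∈ [0, 1]`.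
The set `t A + (1 - t) B` need not be measurable; `μ` is applied to it as an outer measure, which
for Borel sets in `ℝ^d` (where this set is analytic) is its measure under the completion of `μ`. -/
def IsLogConcaveMeasure {E : Type*} [AddCommGroup E] [Module ℝ E] [MeasurableSpace E]
    (μ : Measure E) : Prop :=
  ∀ A B : Set E, MeasurableSet A → MeasurableSet B → A.Nonempty → B.Nonempty →
    ∀ t : ℝ, t ∈ Set.Icc (0 : ℝ) 1 →
      μ A ^ t * μ B ^ (1 - t) ≤ μ (t • A + (1 - t) • B)

/-- `ℝ^∞` written as the product of the spaces `ℝ^(m 0), ℝ^(m 1), …`,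
with the product topology and the product sigma-algebra. -/
abbrev BlockSpace (m : ℕ → ℕ) : Type := ∀ j : ℕ, Fin (m j) → ℝ

/-- The product of the blocks `ℝ^(m j)` with `j ≥ k`, that is, of all but the first `k` blocks. -/
abbrev TailSpace (m : ℕ → ℕ) (k : ℕ) : Type := ∀ j : Set.Ici k, Fin (m j) → ℝ

/-- The map `x ↦ (x_0, …, x_(k-1), 0, 0, …)` that keeps the first `k` blocks. -/
def headPart (m : ℕ → ℕ) (k : ℕ) (x : BlockSpace m) : BlockSpace m :=
  fun j => if j < k then x j else 0

/-- The map `(y_k, y_(k+1), …) ↦ (0, …, 0, y_k, y_(k+1), …)`, with zeros in the first `k` blocks. -/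
def extendTail (m : ℕ → ℕ) (k : ℕ) (y : TailSpace m k) : BlockSpace m :=
  fun j => if h : k ≤ j then y ⟨j, h⟩ else 0

/-- The sigma-algebra on `ℝ^∞` generated by the coordinates of the first `k` blocks. -/
abbrev headSigma (m : ℕ → ℕ) (k : ℕ) : MeasurableSpace (BlockSpace m) :=
  ⨆ j : Set.Iio k, MeasurableSpace.comap (fun x : BlockSpace m => x j) inferInstance

/-- The product of the measures `μ j` with `j ≥ k`. -/
noncomputable def tailMeasure {m : ℕ → ℕ} (μ : ∀ j, Measure (Fin (m j) → ℝ))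
    [∀ j, IsProbabilityMeasure (μ j)] (k : ℕ) : Measure (TailSpace m k) :=
  Measure.infinitePi (fun j : Set.Ici k => μ j)

/-- The constant `c_k`: the integral of `f(0, …, 0, y_k, y_(k+1), …)`
over the product of the blocks `j ≥ k`. -/
noncomputable def tailMean {m : ℕ → ℕ} (μ : ∀ j, Measure (Fin (m j) → ℝ))
    [∀ j, IsProbabilityMeasure (μ j)] (f : BlockSpace m →ₗ[ℝ] ℝ) (k : ℕ) : ℝ :=
  ∫ y, f (extendTail m k y) ∂(tailMeasure μ k)

open ProbabilityTheory

/-! ### Fourth moments from geometric tail bounds -/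

section TailMoments

variable {E : Type*} [MeasurableSpace E] {μ : Measure E} [IsProbabilityMeasure μ]

/-! Split `f` into its head `S_k`, depending on the first `k` blocks, and its tail `T_k`, depending
on the others. The head is a finite sum of linear forms on finite-dimensional blocks, hence
continuous, and the two parts are independent. Once `f` is integrable, `E[f | B_k] = S_k + c_k`;
martingale convergence and `c_k → 0` give `S_k → f` almost everywhere.

The work lies in integrability (`integrable_of_isLogConcaveMeasure`). Log-concavity is used one
block at a time, never for the product. Borell's lemma bounds the fourth moment of a linear form on
a block by a universal multiple of its squared second moment
(`IsLogConcaveMeasure.integral_pow_four_le`). For centered forms this survives independent summation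
with the same constant, so it holds for centered heads, uniformly in `k`. By Fubini, freezing the
tail shows that `S_k` lies within a fixed `t` of some constant `a_k` with probability near one, and
the moment comparison turns this into `E (S_k - a_k)² ≤ 2t²`
(`integral_sub_sq_le_of_measureReal_le`). Finally `|f|` is dominated, up to constants, by `liminf
|S_k - a_k|`, integrable by Fatou (`integrable_of_indep_decomposition`). -/

theorem summable_quartic_geometric :
    Summable fun n : ℕ => 81 * ((n : ℝ) + 1) ^ 4 * (1 / 3) ^ (n + 1) := by
  have h := (summable_nat_add_iff 1).2
    (summable_pow_mul_geometric_of_norm_lt_one 4 (r := (1 / 3 : ℝ)) (by norm_num))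
  simpa [mul_assoc] using h.mul_left 81

/-- The constant comparing the fourth moment with a quantile. -/
noncomputable def quarticConst : ℝ := 1 + ∑' n : ℕ, 81 * ((n : ℝ) + 1) ^ 4 * (1 / 3) ^ (n + 1)

theorem one_le_quarticConst : 1 ≤ quarticConst :=
  le_add_of_nonneg_right (tsum_nonneg fun _ => by positivity)

/-- Layers `(2n+1)r < |u| ≤ (2n+3)r` have geometrically small mass, which beats the quartic growth
of `u ^ 4` on them. -/
theorem lintegral_pow_four_le {u : E → ℝ} (hu : Measurable u) {r : ℝ} (hr : 0 < r)
    (h : ∀ n : ℕ, μ.real {x | (2 * n + 1) * r < |u x|} ≤ (1 / 3) ^ (n + 1)) :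
    ∫⁻ x, ENNReal.ofReal (u x ^ 4) ∂μ ≤ ENNReal.ofReal (quarticConst * r ^ 4) := by
  set B : ℕ → Set E := fun n => {x | (2 * (n : ℝ) + 1) * r < |u x|} with hB
  have hBm : ∀ n, MeasurableSet (B n) := fun n => measurableSet_lt measurable_const hu.abs
  set w : ℕ → ℝ := fun n => 81 * ((n : ℝ) + 1) ^ 4 * r ^ 4 with hw
  have hpt : ∀ x, ENNReal.ofReal (u x ^ 4) ≤ ENNReal.ofReal (r ^ 4) +
      ∑' n, (B n).indicator (fun _ => ENNReal.ofReal (w n)) x := by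
    intro x
    have hex : ∃ n : ℕ, |u x| ≤ (2 * n + 1) * r := by
      obtain ⟨n, hn⟩ := exists_nat_ge (|u x| / r)
      refine ⟨n, ?_⟩
      rw [div_le_iff₀ hr] at hn
      nlinarith [n.cast_nonneg (α := ℝ)]
    classical
    have h4 : u x ^ 4 = |u x| ^ 4 := ((by decide : Even 4).pow_abs _).symm
    rcases hN : Nat.find hex with _ | n
    · have := Nat.find_spec hex
      rw [hN] at this
      refine le_add_right (ENNReal.ofReal_le_ofReal ?_)
      rw [h4]
      exact pow_le_pow_left₀ (abs_nonneg _) (by simpa using this) 4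
    · have h1 := Nat.find_spec hex
      have h2 := Nat.find_min hex (m := n) (by omega)
      rw [hN] at h1
      push_cast at h1
      refine le_add_left (le_trans ?_ (ENNReal.le_tsum n))
      rw [Set.indicator_of_mem (show x ∈ B n from not_le.1 h2)]
      refine ENNReal.ofReal_le_ofReal ?_
      rw [h4, hw]
      -- Here `2(n+1) + 1 ≤ 3(n+1)`, whence the factor `81 = 3 ^ 4`.
      calc |u x| ^ 4 ≤ ((3 * (n + 1)) * r) ^ 4 := by
            refine pow_le_pow_left₀ (abs_nonneg _) (h1.trans ?_) 4
            gcongr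
            linarith [n.cast_nonneg (α := ℝ)]
        _ = _ := by ring
  have hterm : ∀ n, ∫⁻ x, (B n).indicator (fun _ => ENNReal.ofReal (w n)) x ∂μ ≤
      ENNReal.ofReal (81 * ((n : ℝ) + 1) ^ 4 * (1 / 3) ^ (n + 1) * r ^ 4) := by
    intro n
    rw [lintegral_indicator_const (hBm n), ← ofReal_measureReal,
      ← ENNReal.ofReal_mul (by positivity)]
    refine ENNReal.ofReal_le_ofReal ?_
    calc w n * μ.real (B n) ≤ w n * (1 / 3) ^ (n + 1) := by gcongr; exact h n
      _ = _ := by rw [hw]; ring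
  calc ∫⁻ x, ENNReal.ofReal (u x ^ 4) ∂μ
      ≤ ∫⁻ x, ENNReal.ofReal (r ^ 4) +
          ∑' n, (B n).indicator (fun _ => ENNReal.ofReal (w n)) x ∂μ := lintegral_mono hpt
    _ = ENNReal.ofReal (r ^ 4) +
          ∑' n, ∫⁻ x, (B n).indicator (fun _ => ENNReal.ofReal (w n)) x ∂μ := by
        rw [lintegral_add_left measurable_const, lintegral_tsum
          (fun n => (measurable_const.indicator (hBm n)).aemeasurable)]
        simp
    _ ≤ ENNReal.ofReal (r ^ 4) + ∑' n : ℕ, ENNReal.ofReal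
          (81 * ((n : ℝ) + 1) ^ 4 * (1 / 3) ^ (n + 1) * r ^ 4) := by
        gcongr with n; exact hterm n
    _ = ENNReal.ofReal (quarticConst * r ^ 4) := by
        rw [← ENNReal.ofReal_tsum_of_nonneg (fun _ => by positivity)
          (summable_quartic_geometric.mul_right _), ← ENNReal.ofReal_add (by positivity)
          (tsum_nonneg fun _ => by positivity), tsum_mul_right, quarticConst, add_mul, one_mul]

theorem exists_measureReal_lt_abs_le {u : E → ℝ} (hu : AEMeasurable u μ) {ε : ℝ} (hε : 0 < ε) :
    ∃ r : ℝ, 0 < r ∧ μ.real {x | r < |u x|} ≤ ε := by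
  have h : Tendsto (fun n : ℕ => μ {x | (n : ℝ) < |u x|}) atTop
      (𝓝 (μ (⋂ n : ℕ, {x | (n : ℝ) < |u x|}))) := by
    refine tendsto_measure_iInter_atTop (fun n => ?_) (fun a b hab x hx => ?_)
      ⟨0, measure_ne_top _ _⟩
    · exact nullMeasurableSet_lt aemeasurable_const (hu.norm)
    · exact lt_of_le_of_lt (by exact_mod_cast hab : (a : ℝ) ≤ b) hx
  have he : (⋂ n : ℕ, {x | (n : ℝ) < |u x|}) = ∅ := by
    ext x
    obtain ⟨n, hn⟩ := exists_nat_ge |u x|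
    simp only [Set.mem_iInter, Set.mem_ofPred_eq, Set.mem_empty_iff_false, iff_false, not_forall,
      not_lt]
    exact ⟨n, hn⟩
  rw [he, measure_empty] at h
  obtain ⟨n, hn, hn1⟩ := ((h.eventually_lt_const (ENNReal.ofReal_pos.2 hε)).and
    (eventually_ge_atTop 1)).exists
  exact ⟨n, by exact_mod_cast hn1, ENNReal.toReal_le_of_le_ofReal hε.le hn.le⟩

theorem memLp_four_of_lintegral_pow_four {μ : Measure E} {u : E → ℝ} (hu : Measurable u)
    (h : ∫⁻ x, ENNReal.ofReal (u x ^ 4) ∂μ < ∞) : MemLp u 4 μ := by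
  refine ⟨hu.aestronglyMeasurable, ?_⟩
  rw [eLpNorm_lt_top_iff_lintegral_rpow_enorm_lt_top (by norm_num) (by norm_num)]
  refine lt_of_le_of_lt (le_of_eq (lintegral_congr fun x => ?_)) h
  have h4 : u x ^ 4 = |u x| ^ 4 := ((by decide : Even 4).pow_abs _).symm
  rw [h4, ENNReal.ofReal_pow (abs_nonneg _), Real.enorm_eq_ofReal_abs]
  rw [show (4 : ℝ≥0∞).toReal = ((4 : ℕ) : ℝ) by simp, ENNReal.rpow_natCast]

theorem MeasureTheory.MemLp.integrable_pow_of_le_four {u : E → ℝ} (hu : MemLp u 4 μ) {n : ℕ}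
    (hn : n ≤ 4) : Integrable (fun x => u x ^ n) μ := by
  have h1 : MemLp u n μ := hu.mono_exponent (by exact_mod_cast hn)
  rcases Nat.eq_zero_or_pos n with rfl | hpos
  · simp
  have h := h1.integrable_norm_pow (p := n) hpos.ne'
  refine (integrable_norm_iff (h1.1.pow n)).1 (h.congr (ae_of_all _ fun x => ?_))
  simp

end TailMoments

/-! ### Borell's lemma and moment comparison on one block -/

section LogConcave

variable {E : Type*} [AddCommGroup E] [Module ℝ E] [MeasurableSpace E] {μ : Measure E}
  [IsProbabilityMeasure μ]

/-- Borell's lemma for slabs. -/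
theorem IsLogConcaveMeasure.measureReal_lt_abs_sub_le (hμ : IsLogConcaveMeasure μ)
    {l : E →ₗ[ℝ] ℝ} (hl : Measurable l) (e : ℝ) {r : ℝ}
    (hp : μ.real {x | r < |l x - e|} ≤ 1 / 4) (n : ℕ) :
    μ.real {x | (2 * n + 1) * r < |l x - e|} ≤ (1 / 3) ^ (n + 1) := by
  have hu : Measurable fun x => |l x - e| := by fun_prop
  set P := {x | r < |l x - e|} with hP
  set B := {x | (2 * (n : ℝ) + 1) * r < |l x - e|} with hB
  have hPm : MeasurableSet P := measurableSet_lt measurable_const hu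
  have hBm : MeasurableSet B := measurableSet_lt measurable_const hu
  have ha : 3 / 4 ≤ μ.real Pᶜ := by
    rw [probReal_compl_eq_one_sub hPm]; linarith
  have hAne : Pᶜ.Nonempty := by
    rw [Set.nonempty_iff_ne_empty]; intro h; rw [h] at ha; norm_num at ha
  rcases B.eq_empty_or_nonempty with hBe | hBne
  · rw [hBe]; simp
  have hn : (0 : ℝ) < n + 1 := by positivity
  -- With this weight, a point of `B` mixed with a point of the slab `Pᶜ` deviates by more than
  -- `t(2n+1)r - (1-t)r = r`, so it lies in `P`.
  set t : ℝ := 1 / (n + 1) with ht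
  have htn : t * (n + 1) = 1 := by rw [ht]; field_simp
  have ht0 : 0 < t := by positivity
  have ht1 : t ≤ 1 := by rw [ht, div_le_one hn]; linarith [n.cast_nonneg (α := ℝ)]
  have hsub : t • B + (1 - t) • Pᶜ ⊆ P := by
    rintro _ ⟨_, ⟨b, hb, rfl⟩, _, ⟨a, ha', rfl⟩, rfl⟩
    simp only [hP, hB, Set.mem_ofPred_eq, Set.mem_compl_iff, not_lt] at hb ha' ⊢
    simp only [map_add, map_smul, smul_eq_mul]
    have e1 : t * l b + (1 - t) * l a - e = t * (l b - e) + (1 - t) * (l a - e) := by ring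
    rw [e1]
    have h1 : |t * (l b - e)| ≤ |t * (l b - e) + (1 - t) * (l a - e)| +
        |(1 - t) * (l a - e)| := by
      have := abs_sub (t * (l b - e) + (1 - t) * (l a - e)) ((1 - t) * (l a - e))
      simpa using this
    rw [abs_mul, abs_mul (1 - t), abs_of_pos ht0, abs_of_nonneg (sub_nonneg.2 ht1)] at h1
    have h2 := mul_lt_mul_of_pos_left hb ht0
    have h3 := mul_le_mul_of_nonneg_left ha' (sub_nonneg.2 ht1)
    have h4 : t * ((2 * n + 1) * r) = 2 * r - t * r := by
      linear_combination (2 * r) * htn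
    linarith
  have key := (hμ B Pᶜ hBm hPm.compl hBne hAne t ⟨ht0.le, ht1⟩).trans (measure_mono hsub)
  have key' : μ.real B ^ t * μ.real Pᶜ ^ (1 - t) ≤ μ.real P := by
    have := ENNReal.toReal_mono (measure_ne_top μ P) key
    rwa [ENNReal.toReal_mul, ← ENNReal.toReal_rpow, ← ENNReal.toReal_rpow] at this
  -- Raising to the power `n + 1 = 1/t` clears the real exponents; the bounds `3/4` and `1/4` then
  -- give the ratio `1/3`.
  have key2 : μ.real B * μ.real Pᶜ ^ n ≤ μ.real P ^ (n + 1) := by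
    refine le_trans (le_of_eq ?_) (pow_le_pow_left₀ (by positivity) key' (n + 1))
    rw [mul_pow, ← Real.rpow_natCast (_ ^ t), ← Real.rpow_natCast (_ ^ (1 - t)),
      ← Real.rpow_mul measureReal_nonneg, ← Real.rpow_mul measureReal_nonneg]
    have e2 : (1 - t) * ((n + 1 : ℕ) : ℝ) = n := by push_cast; linear_combination -htn
    have e3 : t * ((n + 1 : ℕ) : ℝ) = 1 := by push_cast; exact htn
    rw [e2, e3, Real.rpow_one, Real.rpow_natCast]
  have h5 : μ.real B * (3 / 4) ^ n ≤ (1 / 4) ^ (n + 1) := calc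
    _ ≤ μ.real B * μ.real Pᶜ ^ n := by gcongr
    _ ≤ _ := key2
    _ ≤ _ := by gcongr
  have h6 : ((1 : ℝ) / 4) ^ (n + 1) = (1 / 4) * (1 / 3) ^ n * (3 / 4) ^ n := by
    rw [mul_assoc, ← mul_pow, pow_succ]; norm_num; ring
  rw [h6] at h5
  have h7 := le_of_mul_le_mul_right h5 (by positivity)
  refine h7.trans ?_
  rw [pow_succ, mul_comm]
  gcongr
  norm_num

theorem IsLogConcaveMeasure.memLp_four (hμ : IsLogConcaveMeasure μ) {l : E →ₗ[ℝ] ℝ}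
    (hl : Measurable l) : MemLp l 4 μ := by
  obtain ⟨r, hr, hr'⟩ := exists_measureReal_lt_abs_le (μ := μ) hl.aemeasurable
    (show (0 : ℝ) < 1 / 4 by norm_num)
  refine memLp_four_of_lintegral_pow_four hl (lt_of_le_of_lt
    (lintegral_pow_four_le hl hr fun n => ?_) ENNReal.ofReal_lt_top)
  simpa using hμ.measureReal_lt_abs_sub_le hl 0 (by simpa using hr') n

/-- Chebyshev at twice the root mean square deviation from `e` supplies the mass `1/4` that starts
Borell's lemma; the factor `16` is `2 ^ 4`. -/
theorem IsLogConcaveMeasure.integral_pow_four_le (hμ : IsLogConcaveMeasure μ) {l : E →ₗ[ℝ] ℝ}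
    (hl : Measurable l) (e : ℝ) :
    ∫ x, (l x - e) ^ 4 ∂μ ≤ 16 * quarticConst * (∫ x, (l x - e) ^ 2 ∂μ) ^ 2 := by
  have hL : MemLp (fun x => l x - e) 4 μ := (hμ.memLp_four hl).sub (memLp_const e)
  have hL2 : Integrable (fun x => (l x - e) ^ 2) μ := (hL.mono_exponent (by norm_num)).integrable_sq
  have hL4 : Integrable (fun x => (l x - e) ^ 4) μ := hL.integrable_pow_of_le_four le_rfl
  have hum : Measurable fun x => l x - e := by fun_prop
  set s := ∫ x, (l x - e) ^ 2 ∂μ with hs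
  have hs0 : 0 ≤ s := integral_nonneg fun x => sq_nonneg _
  rcases hs0.eq_or_lt with h0 | hpos
  · have := (integral_eq_zero_iff_of_nonneg (fun x => sq_nonneg (l x - e)) hL2).1 (hs ▸ h0.symm)
    rw [← h0, integral_congr_ae (g := fun _ => (0 : ℝ))]
    · simp
    · filter_upwards [this] with x hx
      have : l x - e = 0 := by simpa using hx
      simp [this]
  set r := 2 * √s with hrdef
  have hr : 0 < r := by positivity
  have hr2 : r ^ 2 = 4 * s := by rw [hrdef, mul_pow, Real.sq_sqrt hs0]; ring
  have hp : μ.real {x | r < |l x - e|} ≤ 1 / 4 := by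
    have hM := mul_meas_ge_le_integral_of_nonneg (ae_of_all μ fun x => sq_nonneg (l x - e)) hL2
      (4 * s)
    have hsub : μ.real {x | r < |l x - e|} ≤ μ.real {x | 4 * s ≤ (l x - e) ^ 2} := by
      refine measureReal_mono fun x hx => ?_
      simp only [Set.mem_ofPred_eq] at hx ⊢
      rw [← hr2, ← sq_abs (l x - e)]
      exact pow_le_pow_left₀ hr.le hx.le 2
    nlinarith
  have h := lintegral_pow_four_le hum hr (fun n => hμ.measureReal_lt_abs_sub_le hl e hp n)
  rw [← ofReal_integral_eq_lintegral_ofReal hL4 (ae_of_all _ fun x => by positivity)] at h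
  have hK := one_le_quarticConst
  rw [ENNReal.ofReal_le_ofReal_iff (by positivity)] at h
  refine h.trans (le_of_eq ?_)
  have : r ^ 4 = 16 * s ^ 2 := by
    rw [show r ^ 4 = (r ^ 2) ^ 2 by ring, hr2]; ring
  rw [this]; ring

end LogConcave

/-! ### Moment comparison for independent sums, and reverse Hölder -/

section IndependentSums

variable {Ω : Type*} [mΩ : MeasurableSpace Ω] {P : Measure Ω} [IsProbabilityMeasure P]

/-- Centering kills the odd cross terms. The surviving `6 E Y² E Z²` is absorbed by the `2C E Y² E
Z²` on the right, which is why `C ≥ 3` suffices and the constant does not grow. -/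
theorem ProbabilityTheory.IndepFun.integral_add_pow_four_le {Y Z : Ω → ℝ} (h : IndepFun Y Z P)
    (hY : MemLp Y 4 P) (hZ : MemLp Z 4 P) (hY0 : ∫ x, Y x ∂P = 0) (hZ0 : ∫ x, Z x ∂P = 0)
    {C : ℝ} (hC : 3 ≤ C) (hYC : ∫ x, Y x ^ 4 ∂P ≤ C * (∫ x, Y x ^ 2 ∂P) ^ 2)
    (hZC : ∫ x, Z x ^ 4 ∂P ≤ C * (∫ x, Z x ^ 2 ∂P) ^ 2) :
    ∫ x, (Y x + Z x) ^ 4 ∂P ≤ C * (∫ x, (Y x + Z x) ^ 2 ∂P) ^ 2 := by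
  have hind : ∀ i j : ℕ, IndepFun (fun x => Y x ^ i) (fun x => Z x ^ j) P := fun i j =>
    h.comp (φ := fun y : ℝ => y ^ i) (ψ := fun y : ℝ => y ^ j) (by fun_prop) (by fun_prop)
  have hYi : ∀ i : ℕ, i ≤ 4 → Integrable (fun x => Y x ^ i) P :=
    fun i hi => hY.integrable_pow_of_le_four hi
  have hZi : ∀ i : ℕ, i ≤ 4 → Integrable (fun x => Z x ^ i) P :=
    fun i hi => hZ.integrable_pow_of_le_four hi
  have hint : ∀ i j : ℕ, i ≤ 4 → j ≤ 4 → Integrable (fun x => Y x ^ i * Z x ^ j) P :=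
    fun i j hi hj => (hind i j).integrable_mul (hYi i hi) (hZi j hj)
  have hval : ∀ i j : ℕ, i ≤ 4 → j ≤ 4 →
      ∫ x, Y x ^ i * Z x ^ j ∂P = (∫ x, Y x ^ i ∂P) * ∫ x, Z x ^ j ∂P :=
    fun i j hi hj => (hind i j).integral_fun_mul_eq_mul_integral (hYi i hi).1 (hZi j hj).1
  have e2 : ∫ x, (Y x + Z x) ^ 2 ∂P = ∫ x, Y x ^ 2 ∂P + ∫ x, Z x ^ 2 ∂P := by
    have : ∀ x, (Y x + Z x) ^ 2 = Y x ^ 2 + 2 * (Y x ^ 1 * Z x ^ 1) + Z x ^ 2 := fun x => by ring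
    simp_rw [this]
    rw [integral_add ((hYi 2 (by norm_num)).fun_add ((hint 1 1 (by norm_num) (by norm_num)).const_mul 2))
      (hZi 2 (by norm_num)), integral_add (hYi 2 (by norm_num))
      ((hint 1 1 (by norm_num) (by norm_num)).const_mul 2), integral_const_mul,
      hval 1 1 (by norm_num) (by norm_num)]
    simp [hY0]
  have e4 : ∫ x, (Y x + Z x) ^ 4 ∂P =
      ∫ x, Y x ^ 4 ∂P + 6 * ((∫ x, Y x ^ 2 ∂P) * ∫ x, Z x ^ 2 ∂P) + ∫ x, Z x ^ 4 ∂P := by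
    have : ∀ x, (Y x + Z x) ^ 4 = Y x ^ 4 + 4 * (Y x ^ 3 * Z x ^ 1) + 6 * (Y x ^ 2 * Z x ^ 2) +
      4 * (Y x ^ 1 * Z x ^ 3) + Z x ^ 4 := fun x => by ring
    simp_rw [this]
    have i1 := hYi 4 le_rfl
    have i2 := (hint 3 1 (by norm_num) (by norm_num)).const_mul 4
    have i3 := (hint 2 2 (by norm_num) (by norm_num)).const_mul 6
    have i4 := (hint 1 3 (by norm_num) (by norm_num)).const_mul 4
    have i5 := hZi 4 le_rfl
    rw [integral_add (((i1.fun_add i2).fun_add i3).fun_add i4) i5, integral_add ((i1.fun_add i2).fun_add i3) i4,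
      integral_add (i1.fun_add i2) i3, integral_add i1 i2, integral_const_mul, integral_const_mul,
      integral_const_mul, hval 3 1 (by norm_num) (by norm_num),
      hval 2 2 (by norm_num) (by norm_num), hval 1 3 (by norm_num) (by norm_num)]
    simp [hY0, hZ0]
  rw [e2, e4]
  have hp : 0 ≤ (∫ x, Y x ^ 2 ∂P) * ∫ x, Z x ^ 2 ∂P :=
    mul_nonneg (integral_nonneg fun x => sq_nonneg _) (integral_nonneg fun x => sq_nonneg _)
  nlinarith

theorem ProbabilityTheory.iIndepFun.integral_sum_pow_four_le {X : ℕ → Ω → ℝ} (h : iIndepFun X P)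
    (hXm : ∀ j, Measurable (X j)) (hX : ∀ j, MemLp (X j) 4 P) (hX0 : ∀ j, ∫ x, X j x ∂P = 0)
    {C : ℝ} (hC : 3 ≤ C) (hXC : ∀ j, ∫ x, X j x ^ 4 ∂P ≤ C * (∫ x, X j x ^ 2 ∂P) ^ 2) (k : ℕ) :
    MemLp (fun x => ∑ j ∈ Finset.range k, X j x) 4 P ∧
    ∫ x, ∑ j ∈ Finset.range k, X j x ∂P = 0 ∧
    ∫ x, (∑ j ∈ Finset.range k, X j x) ^ 4 ∂P ≤
      C * (∫ x, (∑ j ∈ Finset.range k, X j x) ^ 2 ∂P) ^ 2 := by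
  have hXi : ∀ j, Integrable (X j) P := fun j => (hX j).integrable (by norm_num)
  have hm : ∀ k, MemLp (fun x => ∑ j ∈ Finset.range k, X j x) 4 P :=
    fun k => memLp_finsetSum _ fun j _ => hX j
  have h0 : ∀ k, ∫ x, ∑ j ∈ Finset.range k, X j x ∂P = 0 := fun k => by
    rw [integral_finsetSum _ fun j _ => hXi j]
    simp [hX0]
  refine ⟨hm k, h0 k, ?_⟩
  induction k with
  | zero => simp
  | succ k ih =>
    simp_rw [Finset.sum_range_succ]
    refine IndepFun.integral_add_pow_four_le ?_ (hm k) (hX k) (h0 k) (hX0 k) hC ih (hXC k)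
    have := h.indepFun_finsetSum_of_notMem hXm (s := Finset.range k) (i := k) (by simp)
    convert this using 1
    ext x; simp

/-- A random variable whose fourth moment is controlled by its variance and which is close to a
constant with probability close to one has bounded second moment about that constant. -/
theorem integral_sub_sq_le_of_measureReal_le {Y : Ω → ℝ} (hY : MemLp Y 4 P)
    (hY0 : ∫ x, Y x ∂P = 0) {C : ℝ} (hC : 1 ≤ C)
    (hYC : ∫ x, Y x ^ 4 ∂P ≤ C * (∫ x, Y x ^ 2 ∂P) ^ 2) (b t : ℝ)
    (hp : P.real {x | t < |Y x - b|} ≤ 1 / (32 * C)) :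
    ∫ x, (Y x - b) ^ 2 ∂P ≤ 2 * t ^ 2 := by
  have hYi : Integrable Y P := hY.integrable (by norm_num)
  have hY2 := hY.integrable_pow_of_le_four (n := 2) (by norm_num)
  have hY4 := hY.integrable_pow_of_le_four (n := 4) (by norm_num)
  have hZ : MemLp (fun x => Y x - b) 4 P := hY.sub (memLp_const b)
  have hZ2 := hZ.integrable_pow_of_le_four (n := 2) (by norm_num)
  have hZ4 := hZ.integrable_pow_of_le_four (n := 4) (by norm_num)
  set s := ∫ x, Y x ^ 2 ∂P with hs
  have hs0 : 0 ≤ s := integral_nonneg fun x => sq_nonneg _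
  have e2 : ∫ x, (Y x - b) ^ 2 ∂P = s + b ^ 2 := by
    have : ∀ x, (Y x - b) ^ 2 = Y x ^ 2 - 2 * b * Y x + b ^ 2 := fun x => by ring
    have hi : Integrable (fun x => Y x ^ 2 - 2 * b * Y x) P := hY2.sub (hYi.const_mul _)
    simp_rw [this]
    rw [integral_add hi (integrable_const _),
      integral_sub hY2 (hYi.const_mul _), integral_const_mul, hY0]
    simp [hs]
  have e4 : ∫ x, (Y x - b) ^ 4 ∂P ≤ 8 * C * (s + b ^ 2) ^ 2 := by
    have h1 : ∫ x, (Y x - b) ^ 4 ∂P ≤ ∫ x, (8 * Y x ^ 4 + 8 * b ^ 4) ∂P := by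
      refine integral_mono hZ4 ((hY4.const_mul 8).add (integrable_const _)) fun x => ?_
      have h2 : (Y x - b) ^ 2 ≤ 2 * (Y x ^ 2 + b ^ 2) := by nlinarith [sq_nonneg (Y x + b)]
      have h3 : ((Y x - b) ^ 2) ^ 2 ≤ (2 * (Y x ^ 2 + b ^ 2)) ^ 2 :=
        pow_le_pow_left₀ (sq_nonneg _) h2 2
      have h4 := sq_nonneg (Y x ^ 2 - b ^ 2)
      change (Y x - b) ^ 4 ≤ 8 * Y x ^ 4 + 8 * b ^ 4
      nlinarith
    rw [integral_add (hY4.const_mul 8) (integrable_const _), integral_const_mul] at h1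
    simp only [integral_const, probReal_univ, smul_eq_mul, one_mul] at h1
    have h5 : b ^ 4 ≤ C * b ^ 4 := le_mul_of_one_le_left (by positivity) hC
    have h6 : 0 ≤ C * (s * b ^ 2) := by positivity
    nlinarith
  rw [e2]
  set m := s + b ^ 2 with hm
  rcases (show 0 ≤ m by positivity).eq_or_lt with h0 | hm0
  · rw [← h0]; positivity
  set B := {x | t < |Y x - b|} with hB
  have hBm : NullMeasurableSet B P := nullMeasurableSet_lt aemeasurable_const hZ.1.aemeasurable.norm
  -- On `B` this is the weighted inequality `z ≤ z²/(32Cm) + 8Cm`. After integration each of the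
  -- last two terms is at most `m/4`, leaving `m ≤ t² + m/2`.
  have hpt : ∀ x, (Y x - b) ^ 2 ≤
      t ^ 2 + (1 / (32 * C * m) * (Y x - b) ^ 4 + B.indicator (fun _ => 8 * C * m) x) := by
    intro x
    by_cases hx : x ∈ B
    · rw [Set.indicator_of_mem hx]
      set z := (Y x - b) ^ 2 with hz
      have : (Y x - b) ^ 4 = z ^ 2 := by rw [hz]; ring
      rw [this]
      have h7 : z ≤ 1 / (32 * C * m) * z ^ 2 + 8 * C * m := by
        have h8 : 0 ≤ 1 / (32 * C * m) * (z - 16 * C * m) ^ 2 := by positivity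
        have h9 : 1 / (32 * C * m) * (z - 16 * C * m) ^ 2 =
            1 / (32 * C * m) * z ^ 2 + 8 * C * m - z := by
          have : C ≠ 0 := by positivity
          field_simp
          ring
        linarith
      nlinarith [sq_nonneg t]
    · rw [Set.indicator_of_notMem hx]
      have h7 : |Y x - b| ≤ t := not_lt.1 hx
      have h8 : (Y x - b) ^ 2 ≤ t ^ 2 := by
        rw [← sq_abs (Y x - b)]; exact pow_le_pow_left₀ (abs_nonneg _) h7 2
      have h9 : 0 ≤ 1 / (32 * C * m) * (Y x - b) ^ 4 := by positivity
      linarith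
  have hIi : Integrable (B.indicator (fun _ => 8 * C * m)) P :=
    (integrable_const _).indicator₀ hBm
  have hI := integral_mono hZ2 ((integrable_const (t ^ 2)).add
    ((hZ4.const_mul (1 / (32 * C * m))).add hIi)) hpt
  have hIv : ∫ x, B.indicator (fun _ => 8 * C * m) x ∂P = P.real B * (8 * C * m) := by
    rw [integral_indicator₀ hBm]; simp
  simp only [Pi.add_apply] at hI
  rw [e2, integral_add (integrable_const _) ((hZ4.const_mul _).fun_add hIi),
    integral_add (hZ4.const_mul _) hIi, integral_const_mul, hIv] at hI
  simp only [integral_const, probReal_univ, smul_eq_mul, one_mul] at hI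
  have h10 : 1 / (32 * C * m) * ∫ x, (Y x - b) ^ 4 ∂P ≤ m / 4 := by
    refine (mul_le_mul_of_nonneg_left e4 (by positivity)).trans (le_of_eq ?_)
    have : C ≠ 0 := by positivity
    field_simp
    norm_num
  have h11 : P.real B * (8 * C * m) ≤ m / 4 := by
    refine (mul_le_mul_of_nonneg_right hp (by positivity)).trans (le_of_eq ?_)
    have : C ≠ 0 := by positivity
    field_simp
    norm_num
  linarith

end IndependentSums

/-! ### Integrability from bounded heads and independent tails -/

section Domination

variable {Ω : Type*} [mΩ : MeasurableSpace Ω] {P : Measure Ω} [IsProbabilityMeasure P]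

/-- If `f` splits for every `k` into an `ℱ k`-measurable part that is bounded in `L²` after
centering and a part independent of `ℱ k`, then `f` is integrable. -/
theorem integrable_of_indep_decomposition (ℱ : Filtration ℕ mΩ) (hℱ : ⨆ k, ℱ k = mΩ)
    {G : ℕ → MeasurableSpace Ω} (hG : ∀ k, G k ≤ mΩ) (hind : ∀ k, Indep (G k) (ℱ k) P)
    {f : Ω → ℝ} (hf : Measurable f) {S T : ℕ → Ω → ℝ} (hS : ∀ k, StronglyMeasurable[ℱ k] (S k))
    (hT : ∀ k, Measurable[G k] (T k)) (hST : ∀ k, ∀ᵐ x ∂P, f x = S k x + T k x)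
    (a : ℕ → ℝ) {t : ℝ} (hft : P.real {x | t < |f x|} ≤ 1 / 4)
    (hSt : ∀ k, P.real {x | t < |S k x - a k|} ≤ 1 / 4)
    (hS2i : ∀ k, Integrable (fun x => (S k x - a k) ^ 2) P)
    (hS2 : ∀ k, ∫ x, (S k x - a k) ^ 2 ∂P ≤ 2 * t ^ 2) : Integrable f P := by
  have hSm : ∀ k, Measurable (S k) := fun k => ((hS k).mono (ℱ.le k)).measurable
  have habs : ∀ k x, |S k x - a k| ≤ 1 + (S k x - a k) ^ 2 := fun k x => by
    rw [← sq_abs (S k x - a k)]; nlinarith [sq_nonneg (|S k x - a k| - 1)]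
  have hSi : ∀ k, Integrable (fun x => |S k x - a k|) P := fun k => by
    refine ((integrable_const (1 : ℝ)).add (hS2i k)).mono' (by fun_prop) (ae_of_all _ fun x => ?_)
    simpa using habs k x
  set B : ℕ → Set Ω := fun k => {x | 2 * t < |T k x + a k|} with hB
  have hBm : ∀ k, MeasurableSet[G k] (B k) := fun k =>
    hT k (measurableSet_lt measurable_const (by fun_prop) : MeasurableSet {y | 2 * t < |y + a k|})
  have hBp : ∀ k, P.real (B k) ≤ 1 / 2 := fun k => by
    have hle : P.real (B k) ≤ P.real ({x | t < |f x|} ∪ {x | t < |S k x - a k|}) := by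
      refine ENNReal.toReal_mono (measure_ne_top _ _) (measure_mono_ae ?_)
      filter_upwards [hST k] with x hx hxB
      by_contra hcon
      replace hcon : x ∉ {x | t < |f x|} ∪ {x | t < |S k x - a k|} := hcon
      simp only [Set.mem_union, Set.mem_ofPred_eq, not_or, not_lt] at hcon
      have h1 : 2 * t < |T k x + a k| := hxB
      have h2 : T k x + a k = f x - (S k x - a k) := by rw [hx]; ring
      -- If `f` and `S k - a k` are both at most `t` in absolute value, their difference `T k + a k`
      -- is at most `2t`; hence `B k` has mass at most `1/4 + 1/4`.
      rw [h2] at h1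
      have := abs_sub (f x) (S k x - a k)
      linarith [hcon.1, hcon.2]
    have := measureReal_union_le (μ := P) {x | t < |f x|} {x | t < |S k x - a k|}
    linarith [hft, hSt k]
  -- Truncation is needed because conditional expectations of `f` carry no information before
  -- integrability is known.
  have hφi : ∀ L : ℕ, Integrable (fun x => min |f x| (L : ℝ)) P := fun L => by
    refine (integrable_const (L : ℝ)).mono' (by fun_prop) (ae_of_all _ fun x => ?_)
    rw [Real.norm_of_nonneg (le_min (abs_nonneg _) L.cast_nonneg)]
    exact min_le_right _ _
  have hce : ∀ (L k : ℕ), ∀ᵐ x ∂P, (P[fun x => min |f x| (L : ℝ) | ℱ k]) x - (2 * t + L / 2) ≤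
      |S k x - a k| := by
    intro L k
    -- The truncation is at most `|S k - a k| + w`. Since `w` is independent of `ℱ k`, conditioning
    -- replaces it by its mean, at most `2t + L/2`.
    set w : Ω → ℝ := fun x => 2 * t + (B k).indicator (fun _ => (L : ℝ)) x with hw
    have hwi : Integrable w P :=
      (integrable_const _).add ((integrable_const _).indicator (hG k _ (hBm k)))
    have hwm : StronglyMeasurable[G k] w :=
      (measurable_const.add (measurable_const.indicator (hBm k))).stronglyMeasurable
    have h1 : P[fun x => min |f x| (L : ℝ) | ℱ k] ≤ᵐ[P] P[(fun x => |S k x - a k|) + w | ℱ k] := by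
      refine condExp_mono (hφi L) ((hSi k).add hwi) ?_
      filter_upwards [hST k] with x hx
      simp only [Pi.add_apply, hw]
      by_cases hxB : x ∈ B k
      · rw [Set.indicator_of_mem hxB]
        by_cases ht : 0 ≤ t
        · have := min_le_right |f x| (L : ℝ)
          linarith [abs_nonneg (S k x - a k)]
        · exfalso
          -- A negative `t` would contradict `hft`.
          have h3 : P.real {x | t < |f x|} = 1 := by
            have : {x | t < |f x|} = Set.univ :=
              Set.eq_univ_of_forall fun x => (not_le.1 ht).trans_le (abs_nonneg _)
            rw [this, probReal_univ]
          linarith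
      · rw [Set.indicator_of_notMem hxB]
        have h3 : |T k x + a k| ≤ 2 * t := not_lt.1 hxB
        have h4 : f x = (S k x - a k) + (T k x + a k) := by rw [hx]; ring
        have h5 := abs_add_le (S k x - a k) (T k x + a k)
        rw [← h4] at h5
        linarith [min_le_left |f x| (L : ℝ)]
    have h2 := condExp_add (m := ℱ k) (hSi k) hwi
    have h3 : P[fun x => |S k x - a k| | ℱ k] = fun x => |S k x - a k| :=
      condExp_of_stronglyMeasurable (ℱ.le k)
        ((by fun_prop : Measurable fun y : ℝ => |y - a k|).comp (hS k).measurable).stronglyMeasurable (hSi k)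
    have h4 := condExp_indep_eq (hG k) (ℱ.le k) hwm (hind k)
    have h5 : ∫ x, w x ∂P ≤ 2 * t + L / 2 := by
      rw [hw, integral_add (integrable_const _)
        ((integrable_const _).indicator (hG k _ (hBm k))), integral_indicator (hG k _ (hBm k))]
      simp only [integral_const, probReal_univ, smul_eq_mul, one_mul, measureReal_restrict_apply_univ]
      have := mul_le_mul_of_nonneg_right (hBp k) (Nat.cast_nonneg (α := ℝ) L)
      linarith
    filter_upwards [h1, h2, h4] with x hx1 hx2 hx4
    rw [hx2, Pi.add_apply, h3, hx4] at hx1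
    linarith
  set Y : Ω → ℝ≥0∞ := fun x => liminf (fun k => ENNReal.ofReal |S k x - a k|) atTop with hY
  have hYm : Measurable Y := Measurable.liminf fun k => by fun_prop
  have hYint : ∫⁻ x, Y x ∂P ≤ ENNReal.ofReal (1 + 2 * t ^ 2) := by
    refine (lintegral_liminf_le fun k => by fun_prop).trans ?_
    refine liminf_le_of_frequently_le' (Frequently.of_forall fun k => ?_)
    rw [← ofReal_integral_eq_lintegral_ofReal (hSi k) (ae_of_all _ fun x => abs_nonneg _)]
    refine ENNReal.ofReal_le_ofReal ?_
    refine (integral_mono (hSi k) ((integrable_const (1 : ℝ)).add (hS2i k)) (habs k)).trans ?_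
    simp only [Pi.add_apply]
    rw [integral_add (integrable_const _) (hS2i k)]
    simpa using hS2 k
  have hlev : ∀ L : ℕ, ∀ᵐ x ∂P, Tendsto (fun k => (P[fun x => min |f x| (L : ℝ) | ℱ k]) x) atTop
      (𝓝 (min |f x| (L : ℝ))) := fun L =>
    (hφi L).tendsto_ae_condExp (by rw [hℱ]; exact Measurable.stronglyMeasurable (by fun_prop))
  have hdom : ∀ᵐ x ∂P, ‖f x‖ₑ ≤ 2 * Y x + ENNReal.ofReal (4 * |t| + 1) := by
    filter_upwards [ae_all_iff.2 hlev, ae_all_iff.2 fun L => ae_all_iff.2 (hce L)] with x h1 h2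
    -- The level may depend on `x`, as the exceptional set serves all `L` at once. It leaves `|f x|`
    -- untruncated and loses only `L/2 < (|f x| + 1)/2`, so about half of `|f x|` remains.
    set L := ⌈|f x|⌉₊ with hL
    have hL1 : |f x| ≤ L := Nat.le_ceil _
    have hL2 : (L : ℝ) < |f x| + 1 := Nat.ceil_lt_add_one (abs_nonneg _)
    have h3 : ENNReal.ofReal (|f x| - (2 * t + L / 2)) ≤ Y x := by
      have h4 : Tendsto (fun k => ENNReal.ofReal
          ((P[fun x => min |f x| (L : ℝ) | ℱ k]) x - (2 * t + L / 2))) atTop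
          (𝓝 (ENNReal.ofReal (|f x| - (2 * t + L / 2)))) := by
        have := (h1 L).sub_const (2 * t + L / 2)
        rw [min_eq_left hL1] at this
        exact ENNReal.tendsto_ofReal this
      rw [← h4.liminf_eq]
      exact liminf_le_liminf (Eventually.of_forall fun k => ENNReal.ofReal_le_ofReal (h2 L k))
    calc ‖f x‖ₑ = ENNReal.ofReal |f x| := Real.enorm_eq_ofReal_abs _
      _ ≤ ENNReal.ofReal (2 * (|f x| - (2 * t + L / 2)) + (4 * |t| + 1)) := by
          refine ENNReal.ofReal_le_ofReal ?_
          linarith [le_abs_self t]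
      _ ≤ ENNReal.ofReal (2 * (|f x| - (2 * t + L / 2))) + ENNReal.ofReal (4 * |t| + 1) :=
          ENNReal.ofReal_add_le
      _ ≤ _ := by
          rw [ENNReal.ofReal_mul (by norm_num)]
          gcongr
          simp
  refine ⟨hf.aestronglyMeasurable, ?_⟩
  refine lt_of_le_of_lt (lintegral_mono_ae hdom) ?_
  rw [lintegral_add_right _ measurable_const, lintegral_const_mul _ hYm]
  refine ENNReal.add_lt_top.2 ⟨ENNReal.mul_lt_top (by simp)
    (hYint.trans_lt ENNReal.ofReal_lt_top), ?_⟩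
  simp

end Domination

/-! ### Heads and tails of functionals on `ℝ^∞` -/

section BlockSpace

variable {m : ℕ → ℕ}

/-- The restriction of a linear functional on `ℝ^∞` to one block. -/
noncomputable def blockForm (f : BlockSpace m →ₗ[ℝ] ℝ) (j : ℕ) : (Fin (m j) → ℝ) →ₗ[ℝ] ℝ :=
  f ∘ₗ LinearMap.single ℝ (fun j => Fin (m j) → ℝ) j

theorem continuous_blockForm (f : BlockSpace m →ₗ[ℝ] ℝ) (j : ℕ) : Continuous (blockForm f j) :=
  LinearMap.continuous_of_finiteDimensional _

theorem headPart_eq_sum (k : ℕ) (x : BlockSpace m) :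
    headPart m k x = ∑ j ∈ Finset.range k, Pi.single j (x j) := by
  ext i : 1
  rw [Finset.sum_apply, Finset.sum_pi_single]
  simp [headPart]

theorem apply_headPart (f : BlockSpace m →ₗ[ℝ] ℝ) (k : ℕ) (x : BlockSpace m) :
    f (headPart m k x) = ∑ j ∈ Finset.range k, blockForm f j (x j) := by
  rw [headPart_eq_sum, map_sum]
  rfl

/-- The functional `x ↦ f (x_0, …, x_(k-1), 0, 0, …)`, which is continuous. -/
noncomputable def headForm (f : BlockSpace m →ₗ[ℝ] ℝ) (k : ℕ) : BlockSpace m →L[ℝ] ℝ :=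
  ∑ j ∈ Finset.range k,
    (⟨blockForm f j, continuous_blockForm f j⟩ : (Fin (m j) → ℝ) →L[ℝ] ℝ) ∘L
      ContinuousLinearMap.proj j

theorem headForm_apply (f : BlockSpace m →ₗ[ℝ] ℝ) (k : ℕ) (x : BlockSpace m) :
    headForm f k x = ∑ j ∈ Finset.range k, blockForm f j (x j) := by
  simp [headForm]

theorem headForm_eq (f : BlockSpace m →ₗ[ℝ] ℝ) (k : ℕ) (x : BlockSpace m) :
    headForm f k x = f (headPart m k x) := by
  rw [headForm_apply, apply_headPart]

/-- The restriction of a point of `ℝ^∞` to all but the first `k` blocks. -/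
def tailPart (m : ℕ → ℕ) (k : ℕ) (x : BlockSpace m) : TailSpace m k := fun j => x j

theorem measurable_tailPart (k : ℕ) : Measurable (tailPart m k) :=
  measurable_pi_lambda _ fun j => measurable_pi_apply (j : ℕ)

theorem headPart_add_extendTail (k : ℕ) (x : BlockSpace m) :
    headPart m k x + extendTail m k (tailPart m k x) = x := by
  ext j : 1
  by_cases h : j < k
  · simp [headPart, extendTail, h, not_le.2 h]
  · simp [headPart, extendTail, tailPart, h, not_lt.1 h]

theorem measurable_headForm_headSigma (f : BlockSpace m →ₗ[ℝ] ℝ) (k : ℕ) :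
    Measurable[headSigma m k] (headForm f k) := by
  have : (headForm f k : BlockSpace m → ℝ) =
      fun x => ∑ j ∈ Finset.range k, blockForm f j (x j) := funext (headForm_apply f k)
  rw [this]
  refine Finset.measurable_fun_sum _ fun j hj => ?_
  refine (continuous_blockForm f j).measurable.comp ?_
  refine Measurable.of_comap_le ?_
  exact le_iSup (fun j : Set.Iio k => MeasurableSpace.comap (fun x : BlockSpace m => x j)
    inferInstance) ⟨j, Finset.mem_range.1 hj⟩

theorem headSigma_le (k : ℕ) : headSigma m k ≤ (inferInstance : MeasurableSpace (BlockSpace m)) :=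
  iSup_le fun j => (measurable_pi_apply (j : ℕ)).comap_le

/-- The filtration of `ℝ^∞` by the sigma-algebras of the first `k` blocks. -/
def headFiltration (m : ℕ → ℕ) :
    Filtration ℕ (inferInstance : MeasurableSpace (BlockSpace m)) where
  seq := headSigma m
  mono' _ l hkl := iSup_le fun j => le_iSup (fun j : Set.Iio l =>
    MeasurableSpace.comap (fun x : BlockSpace m => x j) inferInstance)
      ⟨j, lt_of_lt_of_le j.2 hkl⟩
  le' := headSigma_le

theorem iSup_headFiltration :
    ⨆ k, headFiltration m k = (inferInstance : MeasurableSpace (BlockSpace m)) := by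
  refine le_antisymm (iSup_le headSigma_le) (iSup_le fun j => ?_)
  refine le_trans ?_ (le_iSup (fun k => headFiltration m k) (j + 1))
  exact le_iSup (fun i : Set.Iio (j + 1) => MeasurableSpace.comap (fun x : BlockSpace m => x i)
    inferInstance) ⟨j, Nat.lt_succ_self j⟩

/-! ### Splitting the product measure -/

variable (μ : ∀ j, Measure (Fin (m j) → ℝ)) [∀ j, IsProbabilityMeasure (μ j)]

instance isProbabilityMeasure_tailMeasure (k : ℕ) : IsProbabilityMeasure (tailMeasure μ k) := by
  unfold tailMeasure; infer_instance

theorem measurePreserving_tailPart (k : ℕ) :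
    MeasurePreserving (tailPart m k) (Measure.infinitePi μ) (tailMeasure μ k) :=
  ⟨measurable_tailPart k, Measure.infinitePi_map_restrict' μ (I := Set.Ici k)⟩

theorem indep_tailPart_headSigma (k : ℕ) :
    Indep (MeasurableSpace.comap (tailPart m k) inferInstance) (headSigma m k)
      (Measure.infinitePi μ) := by
  have hi : iIndep (fun j => MeasurableSpace.comap (fun x : BlockSpace m => x j) inferInstance)
      (Measure.infinitePi μ) :=
    iIndepFun_infinitePi (P := μ) (X := fun _ x => x) fun _ => measurable_id
  have h := indep_iSup_of_disjoint (fun j => (measurable_pi_apply j).comap_le) hi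
    (S := Set.Ici k) (T := Set.Iio k)
    (Set.disjoint_left.2 fun j h1 h2 => absurd (Set.mem_Iio.1 h2) (not_lt.2 (Set.mem_Ici.1 h1)))
  rw [iSup_subtype', iSup_subtype'] at h
  convert h using 1
  simp only [MeasurableSpace.pi, MeasurableSpace.comap_iSup, MeasurableSpace.comap_comp]
  rfl

theorem measurable_headPart (k : ℕ) : Measurable (headPart m k) := by
  refine measurable_pi_lambda _ fun j => ?_
  by_cases h : j < k
  · simpa [headPart, h] using measurable_pi_apply j
  · simp [headPart, h]

theorem measurable_extendTail (k : ℕ) : Measurable (extendTail m k) := by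
  refine measurable_pi_lambda _ fun j => ?_
  by_cases h : k ≤ j
  · simpa [extendTail, h] using measurable_pi_apply (⟨j, h⟩ : Set.Ici k)
  · simp [extendTail, h]

/-- Resampling the tail independently does not change the law. This gives Fubini between head and
tail without a separate space for the head blocks; on finite-dimensional boxes it is a splitting of
a finite product. -/
theorem measurePreserving_headPart_add_extendTail (k : ℕ) :
    MeasurePreserving (fun p : BlockSpace m × TailSpace m k =>
        headPart m k p.1 + extendTail m k p.2)
      ((Measure.infinitePi μ).prod (tailMeasure μ k)) (Measure.infinitePi μ) := by
  have hm : Measurable fun p : BlockSpace m × TailSpace m k =>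
      headPart m k p.1 + extendTail m k p.2 :=
    ((measurable_headPart k).comp measurable_fst).add
      ((measurable_extendTail k).comp measurable_snd)
  refine ⟨hm, Measure.eq_infinitePi _ fun s t ht => ?_⟩
  classical
  have hpre : (fun p : BlockSpace m × TailSpace m k =>
      headPart m k p.1 + extendTail m k p.2) ⁻¹' Set.pi s t =
      (Set.pi ((s.filter fun j => ¬ k ≤ j : Finset ℕ) : Set ℕ) t) ×ˢ
      (Set.pi ((s.subtype fun j => j ∈ Set.Ici k : Finset (Set.Ici k)) : Set (Set.Ici k))
        fun j => t j : Set (TailSpace m k)) := by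
    ext ⟨x, y⟩
    simp only [Set.mem_preimage, Set.mem_pi, Set.mem_prod, Finset.mem_coe, Finset.mem_filter,
      Finset.mem_subtype]
    constructor
    · intro h
      refine ⟨fun j hj => ?_, fun j hj => ?_⟩
      · simpa [headPart, extendTail, hj.2, not_le.1 hj.2] using h j hj.1
      · have hk : k ≤ (j : ℕ) := j.2
        simpa [headPart, extendTail, hk, not_lt.2 hk] using h j hj
    · rintro ⟨h1, h2⟩ j hj
      by_cases hk : k ≤ j
      · simpa [headPart, extendTail, hk, not_lt.2 hk] using h2 ⟨j, hk⟩ hj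
      · simpa [headPart, extendTail, hk, not_le.1 hk] using h1 j ⟨hj, hk⟩
  rw [Measure.map_apply hm (.pi s.countable_toSet fun j _ => ht j), hpre, Measure.prod_prod,
    Measure.infinitePi_pi _ (fun j _ => ht j), tailMeasure,
    Measure.infinitePi_pi (fun j : Set.Ici k => μ j) (t := fun j : Set.Ici k => t j)
      (fun j _ => ht j),
    Finset.prod_subtype_eq_prod_filter (f := fun j => μ j (t j)), mul_comm]
  exact Finset.prod_filter_mul_prod_filter_not s (fun j => k ≤ j) _

theorem aemeasurable_of_aemeasurable_comp_snd {α β : Type*} [MeasurableSpace α]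
    [MeasurableSpace β] {P : Measure α} {Q : Measure β} [IsProbabilityMeasure P] [SFinite Q]
    {h : β → ℝ} (hh : AEMeasurable (fun p : α × β => h p.2) (P.prod Q)) : AEMeasurable h Q := by
  obtain ⟨x, hx⟩ := (Measure.ae_ae_of_ae_prod hh.ae_eq_mk).exists
  exact ⟨fun y => hh.mk _ (x, y), hh.measurable_mk.comp (by fun_prop), hx⟩

/-! ### Measurability of tails and integrability of the functional -/

variable {μ}

/-- The range of `extendTail` may be a null set, so composition alone proves nothing. After
resampling, `f` minus its continuous head is a function of the tail variable only, and almost every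
section of a measurable version is a version of it. -/
theorem aemeasurable_comp_extendTail {f : BlockSpace m →ₗ[ℝ] ℝ}
    (hf : AEMeasurable f (Measure.infinitePi μ)) (k : ℕ) :
    AEMeasurable (fun y => f (extendTail m k y)) (tailMeasure μ k) := by
  refine aemeasurable_of_aemeasurable_comp_snd (P := Measure.infinitePi μ) ?_
  have h1 := hf.comp_quasiMeasurePreserving
    (measurePreserving_headPart_add_extendTail μ k).quasiMeasurePreserving
  have h2 : AEMeasurable (fun p : BlockSpace m × TailSpace m k => headForm f k p.1)
      ((Measure.infinitePi μ).prod (tailMeasure μ k)) :=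
    ((headForm f k).continuous.measurable.comp measurable_fst).aemeasurable
  refine (h1.sub h2).congr (ae_of_all _ fun p => ?_)
  simp [headForm_eq]

/-- The head functional, centered at its mean `e`, has fourth moment controlled by its variance. -/
theorem headForm_centered_moments (hμ : ∀ j, IsLogConcaveMeasure (μ j))
    (f : BlockSpace m →ₗ[ℝ] ℝ) (k : ℕ) : ∃ e : ℝ,
      MemLp (fun x => headForm f k x - e) 4 (Measure.infinitePi μ) ∧
      ∫ x, (headForm f k x - e) ∂(Measure.infinitePi μ) = 0 ∧
      ∫ x, (headForm f k x - e) ^ 4 ∂(Measure.infinitePi μ) ≤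
        16 * quarticConst * (∫ x, (headForm f k x - e) ^ 2 ∂(Measure.infinitePi μ)) ^ 2 := by
  set e : ℕ → ℝ := fun j => ∫ y, blockForm f j y ∂(μ j) with he
  have hl : ∀ j, Measurable (blockForm f j) := fun j => (continuous_blockForm f j).measurable
  have hmp : ∀ j, MeasurePreserving (fun x : BlockSpace m => x j) (Measure.infinitePi μ) (μ j) :=
    fun j => measurePreserving_eval_infinitePi μ j
  have hlp : ∀ j, MemLp (fun y => blockForm f j y - e j) 4 (μ j) := fun j =>
    ((hμ j).memLp_four (hl j)).sub (memLp_const _)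
  have hint : ∀ (j : ℕ) (n : ℕ), ∫ x, (blockForm f j (x j) - e j) ^ n ∂(Measure.infinitePi μ) =
      ∫ y, (blockForm f j y - e j) ^ n ∂(μ j) := fun j n => by
    rw [← (hmp j).map_eq, integral_map (hmp j).measurable.aemeasurable]
    exact Measurable.aestronglyMeasurable (by have := hl j; fun_prop)
  have key := iIndepFun.integral_sum_pow_four_le (P := Measure.infinitePi μ)
    (X := fun j x => blockForm f j (x j) - e j)
    (iIndepFun_infinitePi (X := fun j y => blockForm f j y - e j) fun j => (hl j).sub_const _)
    (fun j => ((hl j).sub_const _).comp (measurable_pi_apply j))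
    (fun j => (hlp j).comp_measurePreserving (hmp j))
    (fun j => by
      have := hint j 1
      simp only [pow_one] at this
      rw [this, integral_sub (((hμ j).memLp_four (hl j)).integrable (by norm_num))
        (integrable_const _)]
      simp [he])
    (C := 16 * quarticConst) (by linarith [one_le_quarticConst])
    (fun j => by
      rw [hint j 4, hint j 2]
      exact (hμ j).integral_pow_four_le (hl j) (e j)) k
  have hsum : ∀ x : BlockSpace m, ∑ j ∈ Finset.range k, (blockForm f j (x j) - e j) =
      headForm f k x - ∑ j ∈ Finset.range k, e j := fun x => by
    rw [headForm_apply, Finset.sum_sub_distrib]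
  simp_rw [hsum] at key
  exact ⟨_, key⟩

theorem exists_tail_measurable {f : BlockSpace m →ₗ[ℝ] ℝ}
    (hf : AEMeasurable f (Measure.infinitePi μ)) (k : ℕ) :
    ∃ h : TailSpace m k → ℝ, Measurable h ∧
      (fun y => f (extendTail m k y)) =ᵐ[tailMeasure μ k] h ∧
      ∀ᵐ x ∂(Measure.infinitePi μ), f x = headForm f k x + h (tailPart m k x) := by
  have hh := aemeasurable_comp_extendTail hf k
  refine ⟨hh.mk _, hh.measurable_mk, hh.ae_eq_mk, ?_⟩
  have := (measurePreserving_tailPart μ k).quasiMeasurePreserving.ae hh.ae_eq_mk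
  filter_upwards [this] with x hx
  rw [← hx, headForm_eq, ← map_add, headPart_add_extendTail]

/-- By Fubini, some frozen tail `y` has a section no larger than the average; minus the tail value
at `y` serves as `a`. The bound `t` is the same for all `k`. -/
theorem exists_measureReal_lt_abs_headForm_sub_le {f : BlockSpace m →ₗ[ℝ] ℝ}
    (hf : AEMeasurable f (Measure.infinitePi μ)) {t ε : ℝ}
    (ht : (Measure.infinitePi μ).real {x | t < |f x|} ≤ ε) (k : ℕ) :
    ∃ a : ℝ, (Measure.infinitePi μ).real {x | t < |headForm f k x - a|} ≤ ε := by
  obtain ⟨h, hm, hfh, -⟩ := exists_tail_measurable hf k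
  set P := Measure.infinitePi μ
  have hε : 0 ≤ ε := measureReal_nonneg.trans ht
  have hmp := measurePreserving_headPart_add_extendTail μ k
  set E : Set (BlockSpace m × TailSpace m k) := {p | t < |headForm f k p.1 + h p.2|} with hE
  have hS := (headForm f k).continuous.measurable
  have hEm : MeasurableSet E := measurableSet_lt measurable_const
    ((hS.comp measurable_fst).add (hm.comp measurable_snd)).abs
  have hEp : (P.prod (tailMeasure μ k)) E ≤ ENNReal.ofReal ε := by
    have hn : NullMeasurableSet {x | t < |f x|} P :=
      nullMeasurableSet_lt aemeasurable_const hf.norm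
    have h1 : P {x | t < |f x|} ≤ ENNReal.ofReal ε := by
      rw [← ofReal_measureReal]; exact ENNReal.ofReal_le_ofReal ht
    refine le_trans (le_of_eq ?_) h1
    rw [← hmp.measure_preimage hn]
    refine measure_congr ?_
    have h2 := (Measure.quasiMeasurePreserving_snd (μ := P) (ν := tailMeasure μ k)).ae hfh
    filter_upwards [h2] with p hp
    refine propext ?_
    change t < |headForm f k p.1 + h p.2| ↔ t < |f (headPart m k p.1 + extendTail m k p.2)|
    rw [map_add, headForm_eq, ← hp]
  rw [Measure.prod_apply_symm hEm] at hEp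
  obtain ⟨y, hy⟩ := exists_le_lintegral (μ := tailMeasure μ k)
    (measurable_measure_prodMk_right (μ := P) hEm).aemeasurable
  refine ⟨-h y, ENNReal.toReal_le_of_le_ofReal hε ?_⟩
  refine le_trans (le_of_eq ?_) (hy.trans hEp)
  congr 1
  ext x
  simp [hE]

theorem integrable_of_isLogConcaveMeasure (hμ : ∀ j, IsLogConcaveMeasure (μ j))
    {f : BlockSpace m →ₗ[ℝ] ℝ} (hf : AEMeasurable f (Measure.infinitePi μ)) :
    Integrable f (Measure.infinitePi μ) := by
  have hC : 1 ≤ 16 * quarticConst := by linarith [one_le_quarticConst]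
  -- One threshold serves both the second-moment bound with `C = 16 * quarticConst` and the `1/4`
  -- conditions of the domination argument.
  have hε : 1 / (32 * (16 * quarticConst)) ≤ 1 / 4 :=
    one_div_le_one_div_of_le (by norm_num) (by linarith)
  obtain ⟨t, -, ht⟩ := exists_measureReal_lt_abs_le hf
    (show 0 < 1 / (32 * (16 * quarticConst)) by positivity)
  choose a ha using exists_measureReal_lt_abs_headForm_sub_le hf ht
  choose h hm _ hfh using exists_tail_measurable hf
  choose e he4 he0 heC using headForm_centered_moments hμ f
  have hLp : ∀ k, MemLp (fun x => headForm f k x - a k) 4 (Measure.infinitePi μ) := fun k => by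
    have := (he4 k).sub (memLp_const (a k - e k))
    refine this.congr_norm (by fun_prop) (ae_of_all _ fun x => ?_)
    simp
  have hmk : (hf.mk f) =ᵐ[Measure.infinitePi μ] f := hf.ae_eq_mk.symm
  refine Integrable.congr (integrable_of_indep_decomposition (headFiltration m)
    iSup_headFiltration (G := fun k => MeasurableSpace.comap (tailPart m k) inferInstance)
    (fun k => (measurable_tailPart k).comap_le) (indep_tailPart_headSigma μ) hf.measurable_mk
    (S := fun k => headForm f k) (T := fun k x => h k (tailPart m k x))
    (fun k => (measurable_headForm_headSigma f k).stronglyMeasurable)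
    (fun k => (hm k).comp (comap_measurable _)) (fun k => ?_) a (t := t) ?_
    (fun k => (ha k).trans hε) (fun k => (hLp k).integrable_pow_of_le_four (by norm_num))
    (fun k => ?_)) hmk
  · filter_upwards [hmk, hfh k] with x h1 h2
    rw [h1, h2]
  · refine le_trans (le_of_eq ?_) (ht.trans hε)
    refine measureReal_congr ?_
    filter_upwards [hmk] with x hx
    refine propext ?_
    change t < |hf.mk f x| ↔ t < |f x|
    rw [hx]
  -- The moment comparison is for the head centered at its mean `e k`, so the constant `a k` is
  -- shifted by `e k`.
  · have := integral_sub_sq_le_of_measureReal_le (he4 k) (he0 k) hC (heC k) (a k - e k) t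
      (by simpa using ha k)
    simpa using this

end BlockSpace

/-! ### Martingale convergence -/

theorem mainTheorem3 (m : ℕ → ℕ)
    (μ : ∀ j, Measure (Fin (m j) → ℝ)) [∀ j, IsProbabilityMeasure (μ j)]
    (hμ : ∀ j, IsLogConcaveMeasure (μ j))
    (f : BlockSpace m →ₗ[ℝ] ℝ) (hf : AEMeasurable f (Measure.infinitePi μ))
    (hc : Tendsto (tailMean μ f) atTop (𝓝 0)) :
    Integrable f (Measure.infinitePi μ) ∧
    (∀ k, Integrable (fun y => f (extendTail m k y)) (tailMeasure μ k)) ∧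
    ∃ g : ℕ → (BlockSpace m →L[ℝ] ℝ),
      (∀ k x, g k x = f (headPart m k x)) ∧
      (∀ k, ∀ᵐ x ∂(Measure.infinitePi μ),
        g k x = ((Measure.infinitePi μ)[f | headSigma m k]) x - tailMean μ f k) ∧
      ∀ᵐ x ∂(Measure.infinitePi μ), Tendsto (fun k => g k x) atTop (𝓝 (f x)) := by
  have hfi := integrable_of_isLogConcaveMeasure hμ hf
  have hgi : ∀ k, Integrable (headForm f k) (Measure.infinitePi μ) := fun k => by
    obtain ⟨e, he, -⟩ := headForm_centered_moments hμ f k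
    refine ((he.integrable (by norm_num)).add (integrable_const e)).congr (ae_of_all _ fun x => ?_)
    simp
  choose h hm hh hfh using exists_tail_measurable hf
  have hTi : ∀ k, Integrable (fun x => h k (tailPart m k x)) (Measure.infinitePi μ) := fun k => by
    refine (hfi.sub (hgi k)).congr ?_
    filter_upwards [hfh k] with x hx
    simp [hx]
  have hhi : ∀ k, Integrable (h k) (tailMeasure μ k) := fun k =>
    ((measurePreserving_tailPart μ k).integrable_comp (hm k).aestronglyMeasurable).1 (hTi k)
  have hmean : ∀ k, ∫ x, h k (tailPart m k x) ∂(Measure.infinitePi μ) = tailMean μ f k := fun k => by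
    rw [tailMean, integral_congr_ae (hh k), ← (measurePreserving_tailPart μ k).map_eq,
      integral_map (measurable_tailPart k).aemeasurable (hm k).aestronglyMeasurable]
  -- Conditioning on the first `k` blocks fixes the head and averages the independent tail to `c_k`.
  have hce : ∀ k, ∀ᵐ x ∂(Measure.infinitePi μ),
      headForm f k x = ((Measure.infinitePi μ)[f | headSigma m k]) x - tailMean μ f k := by
    intro k
    have h1 : (Measure.infinitePi μ)[f | headSigma m k] =ᵐ[Measure.infinitePi μ]
        (Measure.infinitePi μ)[headForm f k + (fun x => h k (tailPart m k x)) | headSigma m k] :=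
      condExp_congr_ae (hfh k)
    have h2 := condExp_add (m := headSigma m k) (hgi k) (hTi k)
    have h3 := condExp_of_stronglyMeasurable (headSigma_le k)
      (measurable_headForm_headSigma f k).stronglyMeasurable (hgi k)
    have h4 := condExp_indep_eq (μ := Measure.infinitePi μ) (measurable_tailPart k).comap_le
      (headSigma_le k) ((hm k).comp (comap_measurable (tailPart m k))).stronglyMeasurable
      (indep_tailPart_headSigma μ k)
    filter_upwards [h1, h2, h4] with x h1 h2 h4
    rw [h1, h2, Pi.add_apply, h3, ← hmean k]
    change _ = _ + (Measure.infinitePi μ)[h k ∘ tailPart m k | headSigma m k] x - _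
    rw [h4]
    simp
  refine ⟨hfi, fun k => (hhi k).congr (hh k).symm, headForm f, headForm_eq f, hce, ?_⟩
  have hL := tendsto_ae_condExp (μ := Measure.infinitePi μ) (ℱ := headFiltration m) f
  rw [iSup_headFiltration] at hL
  -- Since `f` is measurable only up to null sets, the martingale limit agrees with it almost
  -- everywhere, not identically.
  have hself : (Measure.infinitePi μ)[f | (inferInstance : MeasurableSpace (BlockSpace m))]
      =ᵐ[Measure.infinitePi μ] f :=
    condExp_of_aestronglyMeasurable' le_rfl hf.aestronglyMeasurable hfi
  filter_upwards [hL, hself, ae_all_iff.2 hce] with x h1 h2 h3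
  have h4 := h1.sub hc
  rw [sub_zero, h2] at h4
  exact h4.congr fun k => (h3 k).symm
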